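/- A noncrossing tree with $n$ vertices is a tree on points $v_1,\dots,v_n$, placed in this order on a circle, whose edges, drawn as line segments, do not intersect at interior points (that is, there are no two edges $v_av_c$ and $v_bv_d$ with $a<b<c<d$). It is rooted at $v_1$. A $2$-noncrossing tree is a noncrossing tree whose vertices are labelled with labels in $\{1,2\}$ such that, whenever $v_i$ and $v_j$ with $i<j$ are adjacent and the path from the root $v_1$ to $v_j$ contains $v_i$, the labels of $v_i$ and $v_j$ have sum at most $3$. Let $n>1$. Among all $2$-noncrossing trees with $n$ vertices whose root is labelled $1$ (there is at least one such tree), the average number of vertices labelled $1$ is $\frac{3n^2-n-1}{5n-4}$, and the average number of vertices labelled $2$ is $\frac{2n^2-3n+1}{5n-4}$. Among all $2$-noncrossing trees with $n$ vertices whose root is labelled $2$ (again there is at least one), the average number of vertices labelled $1$ is $\frac{3n-1}{5}$, and the average number of vertices labelled $2$ is $\frac{2n+1}{5}$. -/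

import Mathlib

/-- A graph on the points `v₁, …, vₙ`, placed on a circle in this order (`vᵢ` is the element
`i - 1` of `Fin n`), is a noncrossing tree if it is a tree and no two of its edges, drawn as chords
of the circle, cross: two chords meet in an interior point of both exactly if their end points
alternate along the circle. -/
def IsNoncrossingTree {n : ℕ} (G : SimpleGraph (Fin n)) : Prop :=
  G.IsTree ∧ ∀ a b c d : Fin n, a < b → b < c → c < d → ¬(G.Adj a c ∧ G.Adj b d)

/-- A noncrossing tree `G`, rooted at its first vertex, together with a labelling `ℓ` of the
vertices by labels in `[k] = {1, …, k}`, is a `k`-noncrossing tree if the labels of adjacent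
vertices `i < j` have sum at most `k + 1` whenever `i` lies on the path from the root to `j`. -/
def IsKNoncrossingTree (k : ℕ) {n : ℕ} [NeZero n]
    (G : SimpleGraph (Fin n)) (ℓ : Fin n → Set.Icc 1 k) : Prop :=
  IsNoncrossingTree G ∧
    ∀ i j : Fin n, i < j → G.Adj i j →
      (∃ p : G.Walk 0 j, p.IsPath ∧ i ∈ p.support) →
        (ℓ i : ℕ) + (ℓ j : ℕ) ≤ k + 1

open scoped Classical in
/-- The finite set of all `k`-noncrossing trees with `n` vertices whose root is labelled `r`. -/
noncomputable def kNoncrossingTrees (k n r : ℕ) [NeZero n] :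
    Finset (SimpleGraph (Fin n) × (Fin n → Set.Icc 1 k)) :=
  Finset.univ.filter fun T => IsKNoncrossingTree k T.1 T.2 ∧ (T.2 0 : ℕ) = r

/-- The number of vertices labelled `h`. -/
def labelCount {k n : ℕ} (ℓ : Fin n → Set.Icc 1 k) (h : ℕ) : ℕ :=
  (Finset.univ.filter fun v => (ℓ v : ℕ) = h).card

/-- The average number of vertices labelled `h`, over all `k`-noncrossing trees with `n` vertices
whose root is labelled `r`. -/
noncomputable def meanLabelCount (k n r h : ℕ) [NeZero n] : ℚ :=
  (∑ T ∈ kNoncrossingTrees k n r, (labelCount T.2 h : ℚ)) / ((kNoncrossingTrees k n r).card : ℚ)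

/-!
A noncrossing tree rooted at its first vertex is determined by the forest that remains when the root
is removed, and this forest splits recursively: its first root child `c` has descendants on both
sides, which occupy an interval around `c`, and the later root children form a shorter forest. This
codes the trees by labelled ternary trees (`NCForest`). The label condition concerns only edges from
a parent to a child on its right, so it restricts the right forest of a vertex by the label of that
vertex, and leaves the left forest free, as if its root were labelled `1`. The code exists by
`IsNCForest.exists_split`, where planarity makes the descendants of `c` an interval, and it is
unique by `NCForest.Encodes.unique`; `sum_kNoncrossingTrees` transfers sums over trees to sums over
codes.

Let `F` and `H` be the generating functions of the forests below a root labelled `1` and `2`, where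
`X` marks vertices and `q` marks labels `1`. The splitting gives (`NCForest.genFun_eq`) `F = 1 + X
(q F³ + F² H)` and `H = 1 + X q F² H`. At `q = 1` this yields `F = H²` and `H = 1 + X H⁵`. The sums
of the label counts are the derivatives at `q = 1`, which are obtained by taking `q = 1 + ε` in the
dual numbers. Both derivatives are rational in `H`, as is the Euler derivative `θ H`, and the
resulting identities `5 θ F' + F' = 3 θ² F` and `5 H' = 3 θ H + 2 (H - 1)`, where the prime stands
for `d/dq`, relate the coefficients linearly (`PowerSeries.coeff_relations`). These relations are
the claimed averages of the label `1`, so no closed formula for the numbers of trees is needed. The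
averages of the label `2` follow since the two counts add up to `n`.
-/

/-! ### Splitting noncrossing forests -/

/-- A code for a noncrossing forest with labelled vertices, that is, for a noncrossing tree without
its root, whose vertices occupy an interval that does not contain the root. The code `node A l B C`
describes the forest whose first root child `c` has label `l`; `A` codes the descendants of `c` to
the left of `c`, `B` those to the right of `c`, and `C` the trees of the later root children. -/
inductive NCForest (α : Type*)
  | nil : NCForest α
  | node (A : NCForest α) (l : α) (B C : NCForest α) : NCForest α

/-- The parent function `p` makes the interval `[a, b)` a noncrossing forest whose trees hang from
the outer vertex `r`. Acyclicity is expressed by `eq_empty`: no nonempty set of vertices is closed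
under taking parents. In `noncrossing` the edges are the chords `{i, p i}`; those to `r` are
included. -/
structure IsNCForest (p : ℕ → ℕ) (r a b : ℕ) : Prop where
  mapsTo : ∀ j, a ≤ j → j < b → p j = r ∨ (a ≤ p j ∧ p j < b)
  eq_empty : ∀ S : Set ℕ, (∀ j ∈ S, a ≤ j ∧ j < b) → (∀ j ∈ S, p j ∈ S) → S = ∅
  noncrossing : ∀ i j, a ≤ i → i < b → a ≤ j → j < b →
    ¬ (min i (p i) < min j (p j) ∧ min j (p j) < max i (p i) ∧ max i (p i) < max j (p j))

/-- The vertex `j` lies to the right of `c` and before `b`, and its chain of parents stays there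
until it reaches `c`. -/
inductive IsDescendant (p : ℕ → ℕ) (c b : ℕ) : ℕ → Prop
  | child {j : ℕ} (hc : c < j) (hb : j < b) (h : p j = c) : IsDescendant p c b j
  | step {j : ℕ} (hc : c < j) (hb : j < b) (h : IsDescendant p c b (p j)) : IsDescendant p c b j

namespace IsDescendant
variable {p : ℕ → ℕ} {c b j : ℕ}

theorem bounds (h : IsDescendant p c b j) : c < j ∧ j < b := by
  cases h <;> exact ⟨‹_›, ‹_›⟩

theorem parent (h : IsDescendant p c b j) : p j = c ∨ IsDescendant p c b (p j) := by
  cases h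
  · exact Or.inl ‹_›
  · exact Or.inr ‹_›

end IsDescendant

namespace IsNCForest
variable {p : ℕ → ℕ} {r a b c : ℕ}

/-- The acyclicity and noncrossing conditions pass to every subinterval, whatever the new root. -/
theorem mono (h : IsNCForest p r a b) {r' a' b' : ℕ} (ha : a ≤ a') (hb : b' ≤ b)
    (hm : ∀ j, a' ≤ j → j < b' → p j = r' ∨ (a' ≤ p j ∧ p j < b')) : IsNCForest p r' a' b' where
  mapsTo := hm
  eq_empty S hS hp := h.eq_empty S
    (fun j hj => ⟨ha.trans (hS j hj).1, (hS j hj).2.trans_le hb⟩) hp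
  noncrossing i j h1 h2 h3 h4 :=
    h.noncrossing i j (ha.trans h1) (h2.trans_le hb) (ha.trans h3) (h4.trans_le hb)

/-- No edge jumps from the left over the edge that joins `c` to the root `r`. -/
theorem parent_le (h : IsNCForest p r a b) (hr : r < a ∨ b ≤ r) (hac : a ≤ c) (hcb : c < b)
    (hc : p c = r) {j : ℕ} (ha : a ≤ j) (hj : j < c) (hne : p j ≠ r) : p j ≤ c := by
  have h1 := h.noncrossing c j hac hcb ha (by omega)
  have h2 := h.noncrossing j c ha (by omega) hac hcb
  have h3 := h.mapsTo j ha (by omega)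
  rw [hc] at h1 h2
  omega

/-- No edge jumps from the right over the edge that joins `c` to the root `r`. -/
theorem le_parent (h : IsNCForest p r a b) (hr : r < a ∨ b ≤ r) (hac : a ≤ c) (hcb : c < b)
    (hc : p c = r) {j : ℕ} (hj : c < j) (hb : j < b) (hne : p j ≠ r) : c ≤ p j := by
  have h1 := h.noncrossing c j hac hcb (by omega) hb
  have h2 := h.noncrossing j c (by omega) hb hac hcb
  have h3 := h.mapsTo j (by omega) hb
  rw [hc] at h1 h2
  omega

/-- A vertex under an edge `{u, v}` between descendants of `c` is a descendant of `c`: the parents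
of the other vertices under this edge would stay strictly under it, so these vertices would be
closed under taking parents. -/
theorem isDescendant_of_between (h : IsNCForest p r a b) (hac : a ≤ c)
    {i u v x : ℕ} (hi : a ≤ i) (hib : i < b) (hu : u = min i (p i)) (hv : v = max i (p i))
    (hDu : u = c ∨ IsDescendant p c b u) (hDv : IsDescendant p c b v)
    (hux : u < x) (hxv : x < v) : IsDescendant p c b x := by
  have hcu : c ≤ u := by
    rcases hDu with h | h
    · exact h.ge
    · exact h.bounds.1.le
  have hvb := hDv.bounds.2
  by_contra hx
  have := h.eq_empty {y | u < y ∧ y < v ∧ ¬ IsDescendant p c b y} (fun j hj => by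
    obtain ⟨h1, h2, -⟩ := hj; omega) (by
    rintro y ⟨h1, h2, h3⟩
    have hy : p y = c → False := fun e => h3 (.child (by omega) (by omega) e)
    have hy' : IsDescendant p c b (p y) → False := fun e => h3 (.step (by omega) (by omega) e)
    have h5 := h.noncrossing i y hi hib (by omega) (by omega)
    have h6 := h.noncrossing y i (by omega) (by omega) hi hib
    have h7 := h.mapsTo y (by omega) (by omega)
    have h8 : p y ≠ u := by
      rintro e
      rcases hDu with h | h
      · exact hy (e.trans h)
      · exact hy' (e ▸ h)
    have h9 : p y ≠ v := by
      rintro e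
      exact hy' (e ▸ hDv)
    exact ⟨by omega, by omega, hy'⟩)
  exact (Set.mem_empty_iff_false x).1 (this ▸ ⟨hux, hxv, hx⟩)

/-- The descendants of `c` to the right of `c` form an interval that starts right after `c`. -/
theorem isDescendant_of_lt (h : IsNCForest p r a b) (hac : a ≤ c) {y : ℕ}
    (hy : IsDescendant p c b y) : ∀ x, c < x → x < y → IsDescendant p c b x := by
  induction hy with
  | @child j hc hb hj =>
    intro x hx hxy
    exact h.isDescendant_of_between hac (i := j) (u := c) (v := j) (by omega) hb (by omega)
      (by omega) (Or.inl rfl) (.child hc hb hj) hx hxy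
  | @step j hc hb hj ih =>
    intro x hx hxy
    rcases lt_trichotomy x (p j) with hlt | rfl | hgt
    · exact ih x hx hlt
    · exact hj
    · exact h.isDescendant_of_between hac (i := j) (u := p j) (v := j) (by omega) hb (by omega)
        (by omega) (Or.inr hj) (.step hc hb hj) hgt hxy

/-- A nonempty forest splits at its first root child `c` into the left descendants `[a, c)` of `c`,
the right descendants `(c, d)` of `c`, and the trees on `[d, b)` of the later root children. -/
theorem exists_split (h : IsNCForest p r a b) (hr : r < a ∨ b ≤ r) (hab : a < b) :
    ∃ c d, a ≤ c ∧ c < d ∧ d ≤ b ∧ p c = r ∧ IsNCForest p c a c ∧ IsNCForest p c (c + 1) d ∧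
      IsNCForest p r d b := by
  classical
  -- Without a root child the whole interval would be closed under taking parents.
  have hex : ∃ c, a ≤ c ∧ c < b ∧ p c = r := by
    by_contra! hne
    have := h.eq_empty (Set.Ico a b) (fun j hj => hj) (fun j hj =>
      (h.mapsTo j hj.1 hj.2).resolve_left (hne j hj.1 hj.2))
    exact (Set.mem_empty_iff_false a).1 (this ▸ ⟨le_rfl, hab⟩)
  obtain ⟨hac, hcb, hpc⟩ := Nat.find_spec hex
  have hmin := fun j (hj : j < Nat.find hex) => Nat.find_min hex hj
  generalize Nat.find hex = c at hac hcb hpc hmin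
  -- The end `d` of the block of `c` is the first vertex after `c` that does not descend from it.
  have hex2 : ∃ d, c < d ∧ ¬ IsDescendant p c b d :=
    ⟨b, hcb, fun hd => absurd hd.bounds.2 (lt_irrefl b)⟩
  obtain ⟨hcd, hnd⟩ := Nat.find_spec hex2
  have hdmin := fun j (hj : j < Nat.find hex2) => Nat.find_min hex2 hj
  have hdb : Nat.find hex2 ≤ b :=
    Nat.find_min' hex2 ⟨hcb, fun hd => absurd hd.bounds.2 (lt_irrefl b)⟩
  generalize Nat.find hex2 = d at hcd hnd hdmin hdb
  have hD : ∀ j, IsDescendant p c b j → j < d := by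
    intro j hj
    by_contra hlt
    rcases eq_or_lt_of_le (not_lt.1 hlt) with rfl | hlt'
    · exact hnd hj
    · exact hnd (h.isDescendant_of_lt hac hj d hcd hlt')
  refine ⟨c, d, hac, hcd, hdb, hpc, ?_, ?_, ?_⟩
  · refine h.mono le_rfl hcb.le fun j hj hjc => ?_
    have hne : p j ≠ r := fun e => hmin j hjc ⟨hj, hjc.trans hcb, e⟩
    have h1 := h.parent_le hr hac hcb hpc hj hjc hne
    have h2 := h.mapsTo j hj (by omega)
    omega
  · refine h.mono (by omega) hdb fun j hj hjd => ?_
    have hj' : IsDescendant p c b j := by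
      by_contra hn
      exact hdmin j hjd ⟨by omega, hn⟩
    rcases hj'.parent with h1 | h1
    · exact Or.inl h1
    · exact Or.inr ⟨h1.bounds.1, hD _ h1⟩
  · refine h.mono (by omega) le_rfl fun j hj hjb => ?_
    by_cases hne : p j = r
    · exact Or.inl hne
    have h1 := h.le_parent hr hac hcb hpc (by omega) hjb hne
    have h2 := h.mapsTo j (by omega) hjb
    have h3 : ¬ IsDescendant p c b j := fun hj' => absurd (hD j hj') (by omega)
    have h4 : p j ≠ c := fun e => h3 (.child (by omega) hjb e)
    have h5 : d ≤ p j := by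
      by_contra hlt
      refine hdmin (p j) (by omega) ⟨by omega, fun hn => h3 (.step (by omega) hjb hn)⟩
    omega

end IsNCForest

/-! ### Codes of noncrossing forests -/

namespace NCForest
variable {α : Type*}

/-- The number of vertices. -/
def size : NCForest α → ℕ
  | nil => 0
  | node A _ B C => A.size + 1 + B.size + C.size

/-- The code `t` describes the forest with root `r` that the parent function `p` and the labelling
`ℓ` define on the interval `[a, a + t.size)`; the values outside this interval are irrelevant. -/
def Encodes (p : ℕ → ℕ) (ℓ : ℕ → α) : NCForest α → ℕ → ℕ → Prop
  | nil, _, _ => True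
  | node A l B C, a, r => p (a + A.size) = r ∧ ℓ (a + A.size) = l ∧
      Encodes p ℓ A a (a + A.size) ∧ Encodes p ℓ B (a + A.size + 1) (a + A.size) ∧
      Encodes p ℓ C (a + A.size + 1 + B.size) r

/-- Every noncrossing forest has a code. -/
theorem exists_encodes (p : ℕ → ℕ) (ℓ : ℕ → α) {r a b : ℕ} (hab : a ≤ b) (hr : r < a ∨ b ≤ r)
    (h : IsNCForest p r a b) : ∃ t : NCForest α, a + t.size = b ∧ Encodes p ℓ t a r := by
  induction hm : b - a using Nat.strong_induction_on generalizing a b r with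
  | _ m ih =>
    rcases eq_or_lt_of_le hab with rfl | hlt
    · exact ⟨nil, rfl, trivial⟩
    obtain ⟨c, d, hac, hcd, hdb, hpc, hA', hB', hC'⟩ := h.exists_split hr hlt
    obtain ⟨A, hAs, hA⟩ := ih (c - a) (by omega) hac (Or.inr le_rfl) hA' rfl
    obtain ⟨B, hBs, hB⟩ := ih (d - (c + 1)) (by omega) hcd (Or.inl (by omega)) hB' rfl
    obtain ⟨C, hCs, hC⟩ := ih (b - d) (by omega) hdb (by omega) hC' rfl
    subst hAs
    subst hBs
    exact ⟨node A (ℓ (a + A.size)) B C, by simp only [size]; omega, hpc, rfl, hA, hB, hC⟩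

/-- Every code describes a noncrossing forest. -/
theorem Encodes.isNCForest {p : ℕ → ℕ} {ℓ : ℕ → α} : ∀ {t : NCForest α} {a r : ℕ},
    (r < a ∨ a + t.size ≤ r) → Encodes p ℓ t a r → IsNCForest p r a (a + t.size)
  | nil, a, r, _, _ => by
    refine ⟨fun j h1 h2 => ?_, fun S hS _ => ?_, fun i j h1 h2 => ?_⟩
    · simp only [size] at h2; omega
    · refine Set.eq_empty_of_forall_notMem fun j hj => ?_
      have := hS j hj
      simp only [size] at this; omega
    · simp only [size] at h2; omega
  | node A l B C, a, r, hr, h => by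
    obtain ⟨hpc, -, hA, hB, hC⟩ := h
    simp only [size] at hr ⊢
    have hA := hA.isNCForest (Or.inr le_rfl)
    have hB := hB.isNCForest (Or.inl (by omega))
    have hC := hC.isNCForest (by omega)
    obtain ⟨c, hc⟩ : ∃ c, c = a + A.size := ⟨_, rfl⟩
    obtain ⟨d, hd⟩ : ∃ d, d = c + 1 + B.size := ⟨_, rfl⟩
    obtain ⟨b, hb⟩ : ∃ b, b = d + C.size := ⟨_, rfl⟩
    have hb' : a + (A.size + 1 + B.size + C.size) = b := by omega
    rw [hb'] at hr ⊢
    rw [← hc] at hpc hA hB hC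
    rw [← hd] at hB hC
    rw [← hb] at hC
    -- The block of a vertex determines the position of its parent.
    have hcases : ∀ j, a ≤ j → j < b →
        (j < c ∧ (p j = c ∨ (a ≤ p j ∧ p j < c))) ∨ j = c ∧ p j = r ∨
        (c < j ∧ j < d ∧ (p j = c ∨ (c < p j ∧ p j < d))) ∨
        (d ≤ j ∧ (p j = r ∨ (d ≤ p j ∧ p j < b))) := by
      intro j h1 h2
      rcases lt_trichotomy j c with h3 | rfl | h3
      · exact Or.inl ⟨h3, hA.mapsTo j h1 h3⟩
      · exact Or.inr (Or.inl ⟨rfl, hpc⟩)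
      · rcases lt_or_ge j d with h4 | h4
        · exact Or.inr (Or.inr (Or.inl ⟨h3, h4, hB.mapsTo j h3 h4⟩))
        · exact Or.inr (Or.inr (Or.inr ⟨h4, hC.mapsTo j h4 h2⟩))
    refine ⟨fun j h1 h2 => ?_, fun S hS hp => ?_, fun i j hi hib hj hjb => ?_⟩
    · have := hcases j h1 h2
      omega
    · have hrS : r ∉ S := fun hrS => by
        have := hS r hrS
        omega
      have hcS : c ∉ S := fun hcS => hrS (hpc ▸ hp c hcS)
      have key : ∀ r' a' b', IsNCForest p r' a' b' → r' ∉ S → ∀ j ∈ S, a' ≤ j → j < b' → False := by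
        intro r' a' b' hF hr' j hj h1 h2
        have := hF.eq_empty (S ∩ Set.Ico a' b') (fun x hx => hx.2) (fun x hx =>
          ⟨hp x hx.1, (hF.mapsTo x hx.2.1 hx.2.2).resolve_left
            (fun e => hr' (e ▸ hp x hx.1))⟩)
        exact (Set.mem_empty_iff_false j).1 (this ▸ ⟨hj, h1, h2⟩)
      refine Set.eq_empty_of_forall_notMem fun j hj => ?_
      have hj' := hS j hj
      rcases lt_trichotomy j c with h3 | rfl | h3
      · exact key _ _ _ hA hcS j hj hj'.1 h3
      · exact hcS hj
      · rcases lt_or_ge j d with h4 | h4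
        · exact key _ _ _ hB hcS j hj h3 h4
        · exact key _ _ _ hC hrS j hj h4 hj'.2
    · have h1 := hcases i hi hib
      have h2 := hcases j hj hjb
      have hnA := hA.noncrossing i j hi
      have hnB := hB.noncrossing i j
      have hnC := hC.noncrossing i j
      rcases h1 with h1 | h1 | h1 | h1 <;> rcases h2 with h2 | h2 | h2 | h2
      · exact hnA h1.1 hj h2.1
      all_goals first
        | exact hnB h1.1 h1.2.1 h2.1 h2.2.1
        | exact hnC h1.1 hib h2.1 hjb
        | (clear hnA hnB hnC; omega)

/-- If the vertices after `c` can be split both into `B` below `c` and `C` below `r`, and into `B'`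
below `c` and a rest, then `B'` is not longer than `B`: otherwise the vertices of `B'` beyond `B`
lie left of the first root child of `C`, hence they are closed under taking parents. -/
theorem Encodes.size_right_le {p : ℕ → ℕ} {ℓ : ℕ → α} {B C B' : NCForest α} {c r e : ℕ}
    (hr : r < c ∨ e ≤ r) (he : c + 1 + B.size + C.size = e) (hle : c + 1 + B'.size ≤ e)
    (hC : Encodes p ℓ C (c + 1 + B.size) r) (hB' : Encodes p ℓ B' (c + 1) c) :
    B'.size ≤ B.size := by
  by_contra! hlt
  cases C with
  | nil => simp only [size] at he; omega
  | node A₂ l₂ B₂ C₂ =>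
    simp only [size] at he
    have hFB := hB'.isNCForest (Or.inl (by omega))
    obtain ⟨hpc, -, hA, -, -⟩ := hC
    have hFA := hA.isNCForest (Or.inr le_rfl)
    generalize hc₂ : c + 1 + B.size + A₂.size = c₂ at *
    have hc₂' : c + 1 + B'.size ≤ c₂ := by
      by_contra! hlt'
      have := hFB.mapsTo c₂ (by omega) hlt'
      omega
    have := hFA.eq_empty (Set.Ico (c + 1 + B.size) (c + 1 + B'.size))
      (fun j hj => ⟨hj.1, hj.2.trans_le hc₂'⟩) (by
        rintro j ⟨h1, h2⟩
        have h3 := hFA.mapsTo j h1 (by omega)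
        have h4 := hFB.mapsTo j (by omega) h2
        constructor <;> omega)
    exact (Set.mem_empty_iff_false (c + 1 + B.size)).1 (this ▸ ⟨le_rfl, by omega⟩)

/-- A root child of the forest does not lie among the left descendants of the first root child. -/
theorem Encodes.not_lt {p : ℕ → ℕ} {ℓ : ℕ → α} {A : NCForest α} {a c r : ℕ}
    (hA : Encodes p ℓ A a (a + A.size)) (hac : a ≤ c) (hr : r < a ∨ a + A.size < r)
    (hpc : p c = r) : a + A.size ≤ c := by
  by_contra! hlt
  have := (hA.isNCForest (Or.inr le_rfl)).mapsTo c hac hlt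
  omega

/-- A forest of known size has at most one code. -/
theorem Encodes.unique {p : ℕ → ℕ} {ℓ : ℕ → α} : ∀ {t t' : NCForest α} {a r : ℕ},
    (r < a ∨ a + t.size ≤ r) → t.size = t'.size → Encodes p ℓ t a r → Encodes p ℓ t' a r → t = t'
  | nil, nil, _, _, _, _, _, _ => rfl
  | nil, node .., _, _, _, hs, _, _ => by simp only [size] at hs; omega
  | node .., nil, _, _, _, hs, _, _ => by simp only [size] at hs; omega
  | node A l B C, node A' l' B' C', a, r, hr, hs, h, h' => by
    obtain ⟨hpc, hl, hA, hB, hC⟩ := h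
    obtain ⟨hpc', hl', hA', hB', hC'⟩ := h'
    simp only [size] at hr hs
    have e1 : A.size = A'.size := by
      have h1 := hA.not_lt (c := a + A'.size) (r := r) (by omega) (by omega) hpc'
      have h2 := hA'.not_lt (c := a + A.size) (r := r) (by omega) (by omega) hpc
      omega
    rw [← e1] at hpc' hl' hA' hB' hC'
    have e2 : B.size = B'.size := by
      refine le_antisymm ?_ ?_
      · exact Encodes.size_right_le (e := a + (A.size + 1 + B.size + C.size)) (by omega) (by omega)
          (by omega) hC' hB
      · exact Encodes.size_right_le (e := a + (A.size + 1 + B.size + C.size)) (by omega) (by omega)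
          (by omega) hC hB'
    rw [← e2] at hC'
    rw [Encodes.unique (Or.inr le_rfl) e1 hA hA', Encodes.unique (Or.inl (by omega)) e2 hB hB',
      Encodes.unique (by omega) (by omega) hC hC', ← hl, ← hl']

/-- Only the values on the interval of the forest matter. -/
theorem Encodes.congr {p p' : ℕ → ℕ} {ℓ ℓ' : ℕ → α} : ∀ {t : NCForest α} {a r : ℕ},
    (∀ j, a ≤ j → j < a + t.size → p j = p' j) → (∀ j, a ≤ j → j < a + t.size → ℓ j = ℓ' j) →
    Encodes p ℓ t a r → Encodes p' ℓ' t a r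
  | nil, _, _, _, _, _ => trivial
  | node A l B C, a, r, hp, hl, h => by
    obtain ⟨hpc, hlc, hA, hB, hC⟩ := h
    simp only [size] at hp hl
    refine ⟨?_, ?_, hA.congr ?_ ?_, hB.congr ?_ ?_, hC.congr ?_ ?_⟩
    · rw [← hp _ (by omega) (by omega), hpc]
    · rw [← hl _ (by omega) (by omega), hlc]
    all_goals
      intro j h1 h2
      first
        | exact hp j (by omega) (by omega)
        | exact hl j (by omega) (by omega)

/-- A code determines the parents and the labels on its interval. -/
theorem Encodes.eq {p p' : ℕ → ℕ} {ℓ ℓ' : ℕ → α} : ∀ {t : NCForest α} {a r : ℕ},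
    Encodes p ℓ t a r → Encodes p' ℓ' t a r → ∀ j, a ≤ j → j < a + t.size → p j = p' j ∧ ℓ j = ℓ' j
  | nil, _, _, _, _, j, h1, h2 => by simp only [size] at h2; omega
  | node A l B C, a, r, h, h', j, h1, h2 => by
    obtain ⟨hpc, hlc, hA, hB, hC⟩ := h
    obtain ⟨hpc', hlc', hA', hB', hC'⟩ := h'
    simp only [size] at h2
    rcases lt_trichotomy j (a + A.size) with h3 | rfl | h3
    · exact hA.eq hA' j h1 h3
    · exact ⟨hpc.trans hpc'.symm, hlc.trans hlc'.symm⟩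
    · rcases lt_or_ge j (a + A.size + 1 + B.size) with h4 | h4
      · exact hB.eq hB' j h3 h4
      · exact hC.eq hC' j h4 (by omega)

/-- The parent function of the forest coded on an interval that starts at `a`, with root `r`; its
values outside the interval are irrelevant. -/
def parent : NCForest α → ℕ → ℕ → ℕ → ℕ
  | nil, _, _, _ => 0
  | node A _ B C, a, r, j =>
    if j < a + A.size then A.parent a (a + A.size) j
    else if j = a + A.size then r
    else if j < a + A.size + 1 + B.size then B.parent (a + A.size + 1) (a + A.size) j
    else C.parent (a + A.size + 1 + B.size) r j

/-- The labelling of the forest coded on an interval that starts at `a`; the value is `s` at all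
vertices outside the interval. -/
def label (s : α) : NCForest α → ℕ → ℕ → α
  | nil, _, _ => s
  | node A l B C, a, j =>
    if j < a + A.size then A.label s a j
    else if j = a + A.size then l
    else if j < a + A.size + 1 + B.size then B.label s (a + A.size + 1) j
    else C.label s (a + A.size + 1 + B.size) j

theorem encodes_parent_label (s : α) : ∀ (t : NCForest α) (a r : ℕ),
    Encodes (t.parent a r) (t.label s a) t a r
  | nil, _, _ => trivial
  | node A l B C, a, r => by
    refine ⟨?_, ?_, (encodes_parent_label s A _ _).congr ?_ ?_,
      (encodes_parent_label s B _ _).congr ?_ ?_, (encodes_parent_label s C _ _).congr ?_ ?_⟩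
    · simp [parent]
    · simp [label]
    all_goals
      intro j h1 h2
      simp only [parent, label]
      split_ifs <;> first | rfl | omega

theorem label_of_lt (s : α) : ∀ (t : NCForest α) (a j : ℕ), j < a → t.label s a j = s
  | nil, _, _, _ => rfl
  | node A l B C, a, j, h => by
    rw [label, if_pos (by omega), label_of_lt s A a j h]

/-- The label condition for a forest below a root with label `s`. It restricts the root children to
the right of the root only, so a forest to the left of its root is treated like one below a root
with label `1`, for which the condition is void. -/
def Valid {k : ℕ} : ℕ → NCForest (Set.Icc 1 k) → Prop
  | _, nil => True
  | s, node A l B C => s + (l : ℕ) ≤ k + 1 ∧ Valid 1 A ∧ Valid (l : ℕ) B ∧ Valid s C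

/-- `Valid` is the condition on the edges whose parent is the smaller end. If the root `r` lies to
the right of the forest, the bound `s` has to be the neutral value `1`. -/
theorem Encodes.valid_iff {k : ℕ} {p : ℕ → ℕ} {ℓ : ℕ → Set.Icc 1 k} :
    ∀ {t : NCForest (Set.Icc 1 k)} {a r s : ℕ},
    (r < a ∧ (ℓ r : ℕ) = s ∨ a + t.size ≤ r ∧ s = 1) → Encodes p ℓ t a r →
    (Valid s t ↔ ∀ j, a ≤ j → j < a + t.size → p j < j → (ℓ (p j) : ℕ) + (ℓ j : ℕ) ≤ k + 1)
  | nil, a, r, s, _, _ => by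
    refine ⟨fun _ j h1 h2 => ?_, fun _ => trivial⟩
    simp only [size] at h2; omega
  | node A l B C, a, r, s, hr, h => by
    obtain ⟨hpc, hlc, hA, hB, hC⟩ := h
    simp only [size] at hr ⊢
    have iA := hA.valid_iff (s := 1) (Or.inr ⟨le_rfl, rfl⟩)
    have iB := hB.valid_iff (s := (l : ℕ)) (Or.inl ⟨by omega, by rw [hlc]⟩)
    have iC := hC.valid_iff (s := s) (by omega)
    have hl := l.2.2
    rw [Valid, iA, iB, iC]
    constructor
    · rintro ⟨h1, h2, h3, h4⟩ j hj hj' hlt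
      rcases lt_trichotomy j (a + A.size) with h5 | rfl | h5
      · exact h2 j hj h5 hlt
      · rw [hpc] at hlt ⊢
        rw [hlc]
        have := hr.resolve_right (by omega)
        omega
      · rcases lt_or_ge j (a + A.size + 1 + B.size) with h6 | h6
        · exact h3 j h5 h6 hlt
        · exact h4 j h6 (by omega) hlt
    · intro H
      refine ⟨?_, fun j h1 h2 => H j (by omega) (by omega),
        fun j h1 h2 => H j (by omega) (by omega), fun j h1 h2 => H j (by omega) (by omega)⟩
      rcases hr with ⟨hr, rfl⟩ | ⟨hr, rfl⟩
      · have := H (a + A.size) (by omega) (by omega) (by omega)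
        rwa [hpc, hlc] at this
      · omega

/-- The number of vertices labelled `1`. -/
def ones {k : ℕ} : NCForest (Set.Icc 1 k) → ℕ
  | nil => 0
  | node A l B C => A.ones + (if (l : ℕ) = 1 then 1 else 0) + B.ones + C.ones

theorem Encodes.sum_ones {k : ℕ} {p : ℕ → ℕ} {ℓ : ℕ → Set.Icc 1 k} :
    ∀ {t : NCForest (Set.Icc 1 k)} {a r : ℕ}, Encodes p ℓ t a r →
    ∑ j ∈ Finset.range t.size, (if (ℓ (a + j) : ℕ) = 1 then 1 else 0) = t.ones
  | nil, _, _, _ => rfl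
  | node A l B C, a, r, h => by
    obtain ⟨-, hlc, hA, hB, hC⟩ := h
    rw [size, ones, Finset.sum_range_add, Finset.sum_range_add, Finset.sum_range_succ, hA.sum_ones,
      hlc, ← hB.sum_ones, ← hC.sum_ones]
    simp only [add_assoc]

end NCForest

/-! ### Rooted trees and parent maps -/

/-- The edges of `G` join the vertices other than `r` to their parents under `p`, and every vertex
has `r` as an ancestor: no nonempty set that avoids `r` is closed under taking parents. The value `p
r` is irrelevant. -/
structure IsParentMap {V : Type*} (G : SimpleGraph V) (r : V) (p : V → V) : Prop where
  adj_iff : ∀ i j, G.Adj i j ↔ (j ≠ r ∧ p j = i) ∨ (i ≠ r ∧ p i = j)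
  eq_empty : ∀ S : Set V, r ∉ S → (∀ j ∈ S, p j ∈ S) → S = ∅

namespace IsParentMap
variable {V : Type*} {G : SimpleGraph V} {r : V} {p : V → V}

theorem induction (h : IsParentMap G r p) {motive : V → Prop} (root : motive r)
    (step : ∀ j, j ≠ r → motive (p j) → motive j) (j : V) : motive j := by
  by_contra hj
  have := h.eq_empty {v | ¬ motive v} (fun hr => hr root) (fun v hv hpv =>
    hv (step v (fun e => hv (e ▸ root)) hpv))
  exact (Set.mem_empty_iff_false j).1 (this ▸ hj)

theorem exists_depth (h : IsParentMap G r p) : ∃ d : V → ℕ, ∀ j, j ≠ r → d j = d (p j) + 1 := by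
  classical
  have hex : ∀ j, ∃ k, p^[k] j = r := by
    intro j
    induction j using h.induction with
    | root => exact ⟨0, rfl⟩
    | step j _ ih => exact ih.imp' (· + 1) fun _ hk => hk
  refine ⟨fun j => Nat.find (hex j), fun j hj => ?_⟩
  exact Nat.find_comp_succ (hex j) (hex (p j)) hj

theorem adj_parent (h : IsParentMap G r p) {j : V} (hj : j ≠ r) : G.Adj (p j) j :=
  (h.adj_iff _ _).2 (Or.inl ⟨hj, rfl⟩)

/-- The path from the root to `j` runs through the parent of `j`, and no vertex on it is deeper than
`j`. -/
theorem exists_isPath (h : IsParentMap G r p) {d : V → ℕ} (hd : ∀ j, j ≠ r → d j = d (p j) + 1)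
    (j : V) : ∃ q : G.Walk r j, q.IsPath ∧ (∀ v ∈ q.support, d v ≤ d j) ∧
      (j ≠ r → p j ∈ q.support) := by
  induction j using h.induction with
  | root => exact ⟨.nil, .nil, by simp, fun h => absurd rfl h⟩
  | step j hj ih =>
    obtain ⟨q, hq, hqd, -⟩ := ih
    have hdj := hd j hj
    refine ⟨q.concat (h.adj_parent hj), hq.concat (fun hmem => ?_) _, fun v hv => ?_, fun _ => ?_⟩
    · have := hqd j hmem
      omega
    · rw [SimpleGraph.Walk.support_concat, List.mem_append, List.mem_singleton] at hv
      rcases hv with hv | rfl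
      · have := hqd v hv
        omega
      · exact le_rfl
    · exact SimpleGraph.Walk.support_subset_support_concat _ _ q.end_mem_support

theorem isTree [Finite V] (h : IsParentMap G r p) : G.IsTree := by
  classical
  obtain ⟨d, hd⟩ := h.exists_depth
  have : Nonempty V := ⟨r⟩
  have hreach : ∀ j, G.Reachable r j := fun j => ⟨(h.exists_isPath hd j).choose⟩
  rw [SimpleGraph.isTree_iff_connected_and_card]
  refine ⟨⟨fun u v => (hreach u).symm.trans (hreach v)⟩, ?_⟩
  -- Every vertex other than the root corresponds to the edge to its parent.
  let f : {j // j ≠ r} → G.edgeSet := fun j => ⟨s(p j, j), h.adj_parent j.2⟩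
  have hf : Function.Bijective f := by
    constructor
    · rintro ⟨i, hi⟩ ⟨j, hj⟩ hij
      have hij : s(p i, i) = s(p j, j) := congrArg Subtype.val hij
      rcases Sym2.eq_iff.1 hij with ⟨-, e⟩ | ⟨e₁, e₂⟩
      · exact Subtype.ext e
      · have h1 := hd i hi
        have h2 := hd j hj
        rw [e₁] at h1
        rw [← e₂] at h2
        omega
    · rintro ⟨e, he⟩
      induction e with
      | _ i j =>
        rcases (h.adj_iff i j).1 he with ⟨hj, rfl⟩ | ⟨hi, rfl⟩
        · exact ⟨⟨j, hj⟩, rfl⟩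
        · exact ⟨⟨i, hi⟩, Subtype.ext Sym2.eq_swap⟩
  have := Fintype.ofFinite V
  rw [← Nat.card_congr (Equiv.ofBijective f hf), Nat.card_eq_fintype_card,
    Nat.card_eq_fintype_card, Fintype.card_subtype_compl, Fintype.card_subtype_eq]
  have := Fintype.card_pos (α := V)
  omega

/-- This translates the path condition of `IsKNoncrossingTree` into the parent map. -/
theorem ancestor_iff [Finite V] (h : IsParentMap G r p) {i j : V} :
    (G.Adj i j ∧ ∃ q : G.Walk r j, q.IsPath ∧ i ∈ q.support) ↔ j ≠ r ∧ p j = i := by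
  obtain ⟨d, hd⟩ := h.exists_depth
  obtain ⟨q, hq, hqd, hqp⟩ := h.exists_isPath hd j
  constructor
  · rintro ⟨hadj, q', hq', hi⟩
    refine ((h.adj_iff i j).1 hadj).resolve_right ?_
    rintro ⟨hir, rfl⟩
    obtain rfl := (h.isTree.existsUnique_path _ _).unique hq hq'
    have h1 := hqd i hi
    have h2 := hd i hir
    omega
  · rintro ⟨hj, rfl⟩
    exact ⟨h.adj_parent hj, q, hq, hqp hj⟩

end IsParentMap

/-- Every tree has a parent map: the last but one vertex of the path from the root. -/
theorem SimpleGraph.IsTree.exists_isParentMap {V : Type*} {G : SimpleGraph V} (hG : G.IsTree)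
    (r : V) : ∃ p, IsParentMap G r p := by
  choose q hq _ using fun j => hG.existsUnique_path r j
  have hnil : ∀ j, j ≠ r → ¬ (q j).Nil := fun j hj hn => hj hn.eq.symm
  refine ⟨fun j => (q j).penultimate, fun i j => ⟨fun hadj => ?_, ?_⟩, fun S hr hS => ?_⟩
  · by_cases hi : i ∈ (q j).support
    · refine Or.inl ⟨?_, (hG.isAcyclic.eq_penultimate_of_adj_end (hq j) hadj.symm hi).symm⟩
      rintro rfl
      rw [(hG.existsUnique_path _ _).unique (hq j) .nil] at hi
      simp only [SimpleGraph.Walk.support_nil, List.mem_singleton] at hi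
      exact hadj.ne hi
    · have hj := hG.isAcyclic.mem_support_of_ne_mem_support_of_adj_of_isPath (hq i) (hq j) hadj hi
      refine Or.inr ⟨?_, (hG.isAcyclic.eq_penultimate_of_adj_end (hq i) hadj hj).symm⟩
      rintro rfl
      exact hi (q j).start_mem_support
  · rintro (⟨hj, rfl⟩ | ⟨hi, rfl⟩)
    · exact (q j).adj_penultimate (hnil j hj)
    · exact ((q i).adj_penultimate (hnil i hi)).symm
  · by_contra hne
    obtain ⟨j, hj, hmin⟩ := (measure fun j => (q j).length).wf.has_min S
      (Set.nonempty_iff_ne_empty.2 hne)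
    have hjr : j ≠ r := fun e => hr (e ▸ hj)
    refine hmin _ (hS j hj) ?_
    have hq' := (hG.existsUnique_path _ _).unique (hq (q j).penultimate) (hq j).dropLast
    have := SimpleGraph.Walk.length_dropLast_add_one (hnil j hjr)
    change (q (q j).penultimate).length < (q j).length
    rw [hq']
    omega

/-- A parent function on the positions `1, …, n - 1` defines a noncrossing forest below `0` exactly
if it is the parent map of a noncrossing tree on `Fin n` with root `0`. -/
theorem isNCForest_iff_isParentMap {n : ℕ} [NeZero n] {G : SimpleGraph (Fin n)}
    {p : Fin n → Fin n} {P : ℕ → ℕ} (hP : ∀ j : Fin n, j ≠ 0 → P j = p j)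
    (hadj : ∀ i j, G.Adj i j ↔ (j ≠ 0 ∧ p j = i) ∨ (i ≠ 0 ∧ p i = j)) :
    IsNCForest P 0 1 n ↔ IsParentMap G 0 p ∧
      ∀ a b c d : Fin n, a < b → b < c → c < d → ¬ (G.Adj a c ∧ G.Adj b d) := by
  have hne : ∀ j : Fin n, j ≠ 0 ↔ 1 ≤ (j : ℕ) := fun j => by
    rw [← Fin.val_ne_zero_iff, Nat.one_le_iff_ne_zero]
  constructor
  · intro h
    refine ⟨⟨hadj, fun S h0 hS => ?_⟩, fun a b c d hab hbc hcd hcross => ?_⟩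
    · have hSne : ∀ j ∈ S, j ≠ 0 := fun j hj e => h0 (e ▸ hj)
      have := h.eq_empty (Fin.val '' S) (by
        rintro _ ⟨j, hj, rfl⟩
        exact ⟨(hne j).1 (hSne j hj), j.2⟩) (by
        rintro _ ⟨j, hj, rfl⟩
        exact ⟨p j, hS j hj, (hP j (hSne j hj)).symm⟩)
      exact Set.image_eq_empty.1 this
    · rw [hadj, hadj] at hcross
      rw [Fin.lt_def] at hab hbc hcd
      rcases hcross with ⟨⟨h1, rfl⟩ | ⟨h1, rfl⟩, ⟨h2, rfl⟩ | ⟨h2, rfl⟩⟩ <;>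
      · have hn := h.noncrossing _ _ ((hne _).1 h1) (Fin.is_lt _) ((hne _).1 h2) (Fin.is_lt _)
        rw [hP _ h1, hP _ h2] at hn
        omega
  · rintro ⟨h, hcross⟩
    refine ⟨fun j h1 h2 => ?_, fun S hS hpS => ?_, fun i j hi hi' hj hj' => ?_⟩
    · have := hP ⟨j, h2⟩ ((hne _).2 h1)
      have := (p ⟨j, h2⟩).2
      simp only at *
      omega
    · have := h.eq_empty (Fin.val ⁻¹' S) (fun h0 => by
        have := (hS _ h0).1
        simp at this) (fun j hj => by
        rw [Set.mem_preimage, ← hP j ((hne j).2 (hS _ hj).1)]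
        exact hpS _ hj)
      refine Set.eq_empty_of_forall_notMem fun j hj => ?_
      exact (Set.mem_empty_iff_false (⟨j, (hS j hj).2⟩ : Fin n)).1 (this ▸ hj)
    · have hi0 : (⟨i, hi'⟩ : Fin n) ≠ 0 := (hne _).2 hi
      have hj0 : (⟨j, hj'⟩ : Fin n) ≠ 0 := (hne _).2 hj
      have hai := h.adj_parent hi0
      have haj := h.adj_parent hj0
      rw [show P i = p ⟨i, hi'⟩ from hP _ hi0, show P j = p ⟨j, hj'⟩ from hP _ hj0]
      generalize p ⟨i, hi'⟩ = pi at *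
      generalize p ⟨j, hj'⟩ = pj at *
      intro hx
      rcases le_total i pi with h1 | h1 <;> rcases le_total j pj with h2 | h2 <;>
        simp only [h1, h2, min_eq_left, min_eq_right, max_eq_left, max_eq_right] at hx
      · exact hcross ⟨i, hi'⟩ ⟨j, hj'⟩ pi pj hx.1 hx.2.1 hx.2.2 ⟨hai.symm, haj.symm⟩
      · exact hcross ⟨i, hi'⟩ pj pi ⟨j, hj'⟩ hx.1 hx.2.1 hx.2.2 ⟨hai.symm, haj⟩
      · exact hcross pi ⟨j, hj'⟩ ⟨i, hi'⟩ pj hx.1 hx.2.1 hx.2.2 ⟨hai, haj.symm⟩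
      · exact hcross pi pj ⟨i, hi'⟩ ⟨j, hj'⟩ hx.1 hx.2.1 hx.2.2 ⟨hai, haj⟩

/-! ### Trees and codes -/

namespace NCForest

section
variable {α : Type*} [Fintype α]

open scoped Classical in
/-- All codes that are nested at most `m` deep: a finite set that contains the codes of size at most
`m`. -/
noncomputable def ofHeightLE (α : Type*) [Fintype α] : ℕ → Finset (NCForest α)
  | 0 => {nil}
  | m + 1 => insert nil ((ofHeightLE α m ×ˢ Finset.univ ×ˢ ofHeightLE α m ×ˢ ofHeightLE α m).image
      fun x => node x.1 x.2.1 x.2.2.1 x.2.2.2)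

open scoped Classical in
theorem mem_ofHeightLE : ∀ {t : NCForest α} {m : ℕ}, t.size ≤ m → t ∈ ofHeightLE α m
  | nil, 0, _ => by simp [ofHeightLE]
  | nil, m + 1, _ => by simp [ofHeightLE]
  | node A l B C, 0, h => by simp only [size] at h; omega
  | node A l B C, m + 1, h => by
    simp only [size] at h
    refine Finset.mem_insert_of_mem (Finset.mem_image.2 ⟨(A, l, B, C), ?_, rfl⟩)
    simp only [Finset.mem_product, Finset.mem_univ, true_and]
    exact ⟨mem_ofHeightLE (by omega), mem_ofHeightLE (by omega), mem_ofHeightLE (by omega)⟩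

open scoped Classical in
variable (α) in
/-- All codes of forests with `m` vertices. -/
noncomputable def ofSize (m : ℕ) : Finset (NCForest α) :=
  (ofHeightLE α m).filter fun t => t.size = m

@[simp]
theorem mem_ofSize {t : NCForest α} {m : ℕ} : t ∈ ofSize α m ↔ t.size = m := by
  rw [ofSize, Finset.mem_filter, and_iff_right_iff_imp]
  exact fun h => mem_ofHeightLE h.le

theorem sum_ofSize_zero {M : Type*} [AddCommMonoid M] (φ : NCForest α → M) :
    ∑ t ∈ ofSize α 0, φ t = φ nil := by
  rw [show ofSize α 0 = {nil} from ?_, Finset.sum_singleton]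
  ext t
  cases t <;> simp [size]

theorem sum_ofSize_succ {M : Type*} [AddCommMonoid M] (φ : NCForest α → M) (m : ℕ) :
    ∑ t ∈ ofSize α (m + 1), φ t = ∑ l : α, ∑ x ∈ Finset.HasAntidiagonal.antidiagonal m,
      ∑ y ∈ Finset.HasAntidiagonal.antidiagonal x.1, ∑ A ∈ ofSize α y.1,
        ∑ B ∈ ofSize α y.2, ∑ C ∈ ofSize α x.2, φ (node A l B C) := by
  classical
  simp only [← Finset.sum_product', Finset.sum_sigma']
  symm
  refine Finset.sum_bij
    (fun z _ => node z.2.2.2.1 z.1 z.2.2.2.2.1 z.2.2.2.2.2) ?_ ?_ ?_ fun _ _ => rfl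
  · rintro ⟨l, x, y, A, B, C⟩ hz
    simp only [Finset.mem_product, Finset.mem_sigma, Finset.mem_univ, mem_ofSize,
      Finset.HasAntidiagonal.mem_antidiagonal, true_and] at hz
    simp only [mem_ofSize, size]
    omega
  · rintro ⟨l, ⟨x₁, x₂⟩, ⟨y₁, y₂⟩, A, B, C⟩ hz ⟨l', ⟨x₁', x₂'⟩, ⟨y₁', y₂'⟩, A', B', C'⟩ hz' heq
    simp only [Finset.mem_product, Finset.mem_sigma, Finset.mem_univ, mem_ofSize,
      Finset.HasAntidiagonal.mem_antidiagonal, true_and] at hz hz'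
    simp only [node.injEq] at heq
    obtain ⟨rfl, rfl, rfl, rfl⟩ := heq
    obtain ⟨-, rfl, rfl, rfl, rfl⟩ := hz
    obtain ⟨-, rfl, rfl, rfl, rfl⟩ := hz'
    rfl
  · intro t ht
    cases t with
    | nil => simp [size] at ht
    | node A l B C =>
      rw [mem_ofSize, size] at ht
      refine ⟨⟨l, ⟨A.size + B.size, C.size⟩, ⟨A.size, B.size⟩, A, B, C⟩, ?_, rfl⟩
      simp only [Finset.mem_product, Finset.mem_sigma, Finset.mem_univ, mem_ofSize,
        Finset.HasAntidiagonal.mem_antidiagonal, true_and, and_true]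
      omega
end

/-- The graph on `Fin n` that joins every vertex other than the root `0` to its parent in the coded
forest. -/
noncomputable def toGraph {α : Type*} (n : ℕ) [NeZero n] (t : NCForest α) : SimpleGraph (Fin n) :=
  SimpleGraph.fromRel fun i j => j ≠ 0 ∧ t.parent 1 0 j = i

theorem exists_isParentMap_toGraph {α : Type*} {n : ℕ} [NeZero n] (s : α) {t : NCForest α}
    (ht : t.size + 1 = n) : ∃ p : Fin n → Fin n, (∀ j : Fin n, j ≠ 0 → t.parent 1 0 j = p j) ∧
      IsParentMap (t.toGraph n) 0 p ∧
      ∀ a b c d : Fin n, a < b → b < c → c < d →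
        ¬ ((t.toGraph n).Adj a c ∧ (t.toGraph n).Adj b d) := by
  have hF := (encodes_parent_label s t 1 0).isNCForest (Or.inl Nat.one_pos)
  rw [Nat.add_comm, ht] at hF
  have hpos : ∀ j : Fin n, j ≠ 0 → 1 ≤ (j : ℕ) := fun j hj =>
    Nat.one_le_iff_ne_zero.2 (Fin.val_ne_zero_iff.2 hj)
  have hlt : ∀ j : Fin n, j ≠ 0 → t.parent 1 0 j < n := fun j hj => by
    have := hF.mapsTo j (hpos j hj) j.2
    have := j.2
    omega
  classical
  let p : Fin n → Fin n := fun j => if h : j ≠ 0 then ⟨t.parent 1 0 j, hlt j h⟩ else 0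
  have hp : ∀ j : Fin n, j ≠ 0 → t.parent 1 0 j = p j := fun j hj => by simp only [p, dif_pos hj]
  have hne : ∀ j, j ≠ 0 → p j ≠ j := fun j hj e => by
    have := hF.eq_empty {(j : ℕ)} (by rintro _ rfl; exact ⟨hpos j hj, j.2⟩)
      (by rintro _ rfl; exact (hp j hj).trans (congrArg Fin.val e))
    exact Set.singleton_ne_empty _ this
  refine ⟨p, hp, (isNCForest_iff_isParentMap hp fun i j => ?_).1 hF⟩
  have key : ∀ i j : Fin n, (j ≠ 0 ∧ t.parent 1 0 j = i) ↔ (j ≠ 0 ∧ p j = i) := fun i j =>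
    and_congr_right fun hj => by rw [hp j hj, Fin.val_inj]
  rw [toGraph, SimpleGraph.fromRel_adj, key, key, and_iff_right_iff_imp]
  rintro (⟨hj, rfl⟩ | ⟨hi, rfl⟩)
  · exact hne _ hj
  · exact (hne _ hi).symm

end NCForest

/-- The label condition of `IsKNoncrossingTree` in terms of parents. -/
theorem IsParentMap.label_condition_iff {k n : ℕ} [NeZero n] {G : SimpleGraph (Fin n)}
    {p : Fin n → Fin n} {P : ℕ → ℕ} {ℓ : Fin n → Set.Icc 1 k} {L : ℕ → Set.Icc 1 k}
    (h : IsParentMap G 0 p) (hP : ∀ j : Fin n, j ≠ 0 → P j = p j) (hL : ∀ j : Fin n, L j = ℓ j) :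
    (∀ i j : Fin n, i < j → G.Adj i j → (∃ q : G.Walk 0 j, q.IsPath ∧ i ∈ q.support) →
        (ℓ i : ℕ) + (ℓ j : ℕ) ≤ k + 1) ↔
      ∀ j, 1 ≤ j → j < n → P j < j → (L (P j) : ℕ) + (L j : ℕ) ≤ k + 1 := by
  constructor
  · intro H j h1 h2 hlt
    have hj : (⟨j, h2⟩ : Fin n) ≠ 0 := Fin.val_ne_zero_iff.1 (Nat.one_le_iff_ne_zero.1 h1)
    have hPj : P j = p ⟨j, h2⟩ := hP _ hj
    have ha := h.ancestor_iff.2 ⟨hj, rfl⟩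
    have := H (p ⟨j, h2⟩) ⟨j, h2⟩ (Fin.lt_def.2 (hPj ▸ hlt)) ha.1 ha.2
    rwa [hPj, hL, show L j = ℓ ⟨j, h2⟩ from hL ⟨j, h2⟩]
  · intro H i j hij hadj hq
    obtain ⟨hj, rfl⟩ := h.ancestor_iff.1 ⟨hadj, hq⟩
    have := H j (Nat.one_le_iff_ne_zero.2 (Fin.val_ne_zero_iff.2 hj)) j.2
      (by rw [hP j hj]; exact hij)
    rwa [hP j hj, hL, hL] at this

theorem mem_kNoncrossingTrees {k n r : ℕ} [NeZero n] {G : SimpleGraph (Fin n)}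
    {ℓ : Fin n → Set.Icc 1 k} : (G, ℓ) ∈ kNoncrossingTrees k n r ↔
      IsKNoncrossingTree k G ℓ ∧ (ℓ 0 : ℕ) = r := by
  simp [kNoncrossingTrees]

open scoped Classical in
/-- The `k`-noncrossing trees with `m + 1` vertices and root label `s` correspond to the valid codes
of size `m`. -/
theorem sum_kNoncrossingTrees {M : Type*} [AddCommMonoid M] {k n m : ℕ} [NeZero n] (hn : m + 1 = n)
    (s : Set.Icc 1 k) (φ : ℕ → M) :
    ∑ T ∈ kNoncrossingTrees k n s, φ (labelCount T.2 1) =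
      ∑ t ∈ (NCForest.ofSize (Set.Icc 1 k) m).filter (NCForest.Valid (s : ℕ)),
        φ (t.ones + if (s : ℕ) = 1 then 1 else 0) := by
  symm
  refine Finset.sum_bij (fun t _ => (t.toGraph n, fun v : Fin n => t.label s 1 v)) ?_ ?_ ?_ ?_
  · intro t ht
    rw [Finset.mem_filter, NCForest.mem_ofSize] at ht
    obtain ⟨ht, hv⟩ := ht
    obtain ⟨p, hp, hpm, hcross⟩ := NCForest.exists_isParentMap_toGraph (n := n) s (by rw [ht, hn])
    have h0 : t.label s 1 0 = s := NCForest.label_of_lt s t 1 0 Nat.one_pos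
    refine mem_kNoncrossingTrees.2 ⟨⟨⟨hpm.isTree, hcross⟩, ?_⟩, ?_⟩
    · rw [hpm.label_condition_iff hp (L := t.label s 1) fun _ => rfl]
      have := ((NCForest.encodes_parent_label s t 1 0).valid_iff
        (Or.inl ⟨Nat.one_pos, by rw [h0]⟩)).1 hv
      rwa [ht, Nat.add_comm, hn] at this
    · rw [Fin.val_zero, h0]
  · intro t ht t' ht' heq
    rw [Finset.mem_filter, NCForest.mem_ofSize] at ht ht'
    obtain ⟨hG, hℓ⟩ := Prod.ext_iff.1 heq
    simp only at hG hℓ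
    obtain ⟨p, hp, hpm, -⟩ := NCForest.exists_isParentMap_toGraph (n := n) s (by rw [ht.1, hn])
    obtain ⟨p', hp', hpm', -⟩ := NCForest.exists_isParentMap_toGraph (n := n) s (by rw [ht'.1, hn])
    rw [← hG] at hpm'
    refine (NCForest.encodes_parent_label s t 1 0).unique (Or.inl Nat.one_pos)
      (ht.1.trans ht'.1.symm) (NCForest.Encodes.congr ?_ ?_
        (NCForest.encodes_parent_label s t' 1 0))
    · intro j h1 h2
      rw [ht'.1, Nat.add_comm, hn] at h2
      have hj : (⟨j, h2⟩ : Fin n) ≠ 0 := Fin.val_ne_zero_iff.1 (Nat.one_le_iff_ne_zero.1 h1)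
      have := (hpm'.ancestor_iff.1 (hpm.ancestor_iff.2 ⟨hj, rfl⟩)).2
      rw [show t'.parent 1 0 j = p' ⟨j, h2⟩ from hp' _ hj, this,
        show t.parent 1 0 j = p ⟨j, h2⟩ from hp _ hj]
    · intro j h1 h2
      rw [ht'.1, Nat.add_comm, hn] at h2
      exact (congrFun hℓ ⟨j, h2⟩).symm
  · rintro ⟨G, ℓ⟩ hT
    obtain ⟨⟨⟨hG, hcross⟩, hlab⟩, h0⟩ := mem_kNoncrossingTrees.1 hT
    obtain ⟨p, hp⟩ := hG.exists_isParentMap 0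
    let P : ℕ → ℕ := fun j => if h : j < n then p ⟨j, h⟩ else 0
    let L : ℕ → Set.Icc 1 k := fun j => if h : j < n then ℓ ⟨j, h⟩ else s
    have hP : ∀ j : Fin n, j ≠ 0 → P j = p j := fun j _ => by simp [P]
    have hL : ∀ j : Fin n, L j = ℓ j := fun j => by simp [L]
    have hF := (isNCForest_iff_isParentMap hP hp.adj_iff).2 ⟨hp, hcross⟩
    obtain ⟨t, ht, hE⟩ := NCForest.exists_encodes P L (by omega) (Or.inl Nat.one_pos) hF
    have hE' := hE.eq (NCForest.encodes_parent_label s t 1 0)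
    rw [ht] at hE'
    have hs : L 0 = s := by
      rw [← Fin.val_zero n, hL]
      exact Subtype.ext h0
    refine ⟨t, Finset.mem_filter.2 ⟨NCForest.mem_ofSize.2 (by omega), ?_⟩, Prod.ext ?_ ?_⟩
    · rw [hE.valid_iff (Or.inl ⟨Nat.one_pos, by rw [hs]⟩), ht]
      exact (hp.label_condition_iff hP hL).1 hlab
    · obtain ⟨p', hp', hpm', -⟩ :=
        NCForest.exists_isParentMap_toGraph (n := n) s (t := t) (by omega)
      have hpp : ∀ j, j ≠ 0 → p' j = p j := fun j hj => Fin.ext <| by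
        rw [← hp' j hj, ← hP j hj, (hE' j _ j.2).1]
        exact Nat.one_le_iff_ne_zero.2 (Fin.val_ne_zero_iff.2 hj)
      ext i j
      rw [hpm'.adj_iff, hp.adj_iff]
      exact or_congr (and_congr_right fun hj => by rw [hpp j hj])
        (and_congr_right fun hi => by rw [hpp i hi])
    · funext v
      change t.label s 1 v = ℓ v
      rw [← hL v]
      by_cases hv : v = 0
      · subst hv
        rw [Fin.val_zero, hs]
        exact NCForest.label_of_lt s t 1 0 Nat.one_pos
      · exact ((hE' v (Nat.one_le_iff_ne_zero.2 (Fin.val_ne_zero_iff.2 hv)) v.2).2).symm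
  · intro t ht
    rw [Finset.mem_filter, NCForest.mem_ofSize] at ht
    congr 1
    subst hn
    rw [labelCount, Finset.card_filter, Fin.sum_univ_eq_sum_range
      (fun j => if ((t.label s 1 j : Set.Icc 1 k) : ℕ) = 1 then 1 else 0), Finset.sum_range_succ',
      NCForest.label_of_lt s t 1 0 Nat.one_pos, ← ht.1,
      ← (NCForest.encodes_parent_label s t 1 0).sum_ones]
    simp only [Nat.add_comm 1]

/-! ### Generating functions -/

namespace NCForest
open PowerSeries

open scoped Classical in
/-- The generating function of the valid forests below a root with label `s`: the variable marks the
vertices, and `q` marks the vertices labelled `1`. -/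
noncomputable def genFun {R : Type*} [CommRing R] (q : R) (k s : ℕ) : R⟦X⟧ :=
  PowerSeries.mk fun m => ∑ t ∈ ofSize (Set.Icc 1 k) m, if Valid s t then q ^ t.ones else 0

/-- The functional equation that the splitting of a nonempty forest at its first root child yields.
-/
theorem genFun_eq {R : Type*} [CommRing R] (q : R) (k s : ℕ) :
    genFun q k s = 1 + X * ∑ l : Set.Icc 1 k, if s + (l : ℕ) ≤ k + 1 then
      C (if (l : ℕ) = 1 then q else 1) * (genFun q k 1 * genFun q k l * genFun q k s) else 0 := by
  classical
  ext m
  cases m with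
  | zero => simp [genFun, sum_ofSize_zero, Valid, ones]
  | succ m =>
    rw [map_add, coeff_one, if_neg m.succ_ne_zero, zero_add, coeff_succ_X_mul, map_sum, genFun,
      coeff_mk, sum_ofSize_succ]
    refine Finset.sum_congr rfl fun l _ => ?_
    by_cases hl : s + (l : ℕ) ≤ k + 1
    · rw [if_pos hl, ← genFun, coeff_C_mul, coeff_mul, Finset.mul_sum]
      refine Finset.sum_congr rfl fun x _ => ?_
      rw [coeff_mul, Finset.sum_mul, Finset.mul_sum]
      refine Finset.sum_congr rfl fun y _ => ?_
      rw [genFun, genFun, genFun, coeff_mk, coeff_mk, coeff_mk, Finset.sum_mul, Finset.sum_mul,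
        Finset.mul_sum]
      refine Finset.sum_congr rfl fun A _ => ?_
      rw [mul_assoc, Finset.sum_mul, Finset.mul_sum, Finset.mul_sum]
      refine Finset.sum_congr rfl fun B _ => ?_
      rw [Finset.mul_sum, Finset.mul_sum, Finset.mul_sum]
      refine Finset.sum_congr rfl fun D _ => ?_
      have hone : q ^ (if (l : ℕ) = 1 then 1 else 0) = if (l : ℕ) = 1 then q else 1 := by
        split_ifs <;> simp
      by_cases hA : Valid 1 A
      · by_cases hB : Valid (l : ℕ) B
        · by_cases hD : Valid s D
          · rw [if_pos ⟨hl, hA, hB, hD⟩, if_pos hA, if_pos hB, if_pos hD, ← hone, ones]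
            ring
          · rw [if_neg fun h => hD h.2.2.2, if_neg hD, mul_zero, mul_zero, mul_zero]
        · rw [if_neg fun h => hB h.2.2.1, if_neg hB, zero_mul, mul_zero, mul_zero]
      · rw [if_neg fun h => hA h.2.1, if_neg hA, zero_mul, mul_zero]
    · rw [if_neg hl, map_zero]
      refine Finset.sum_eq_zero fun x _ => Finset.sum_eq_zero fun y _ => Finset.sum_eq_zero
        fun A _ => Finset.sum_eq_zero fun B _ => Finset.sum_eq_zero fun D _ => ?_
      exact if_neg fun h => hl h.1

theorem sum_Icc_one_two {M : Type*} [AddCommMonoid M] (φ : Set.Icc 1 2 → M) :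
    ∑ l, φ l = φ ⟨1, by simp⟩ + φ ⟨2, by simp⟩ := by
  rw [show (Finset.univ : Finset (Set.Icc 1 2)) = {⟨1, by simp⟩, ⟨2, by simp⟩} by decide]
  exact Finset.sum_pair (by simp)

theorem genFun_two_one {R : Type*} [CommRing R] (q : R) :
    genFun q 2 1 = 1 + X * (C q * (genFun q 2 1 * genFun q 2 1 * genFun q 2 1) +
      genFun q 2 1 * genFun q 2 2 * genFun q 2 1) := by
  conv_lhs => rw [genFun_eq, sum_Icc_one_two]
  simp

theorem genFun_two_two {R : Type*} [CommRing R] (q : R) :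
    genFun q 2 2 = 1 + X * (C q * (genFun q 2 1 * genFun q 2 1 * genFun q 2 2)) := by
  conv_lhs => rw [genFun_eq, sum_Icc_one_two]
  simp

end NCForest

/-! ### Power series over the dual numbers -/

namespace PowerSeries

/-- The coefficientwise value at `ε = 0`. -/
noncomputable def fstPart (F : (DualNumber ℚ)⟦X⟧) : ℚ⟦X⟧ := mk fun m => (coeff m F).fst

/-- The coefficientwise derivative with respect to `ε`. -/
noncomputable def sndPart (F : (DualNumber ℚ)⟦X⟧) : ℚ⟦X⟧ := mk fun m => (coeff m F).snd

theorem fstPart_add (F G : (DualNumber ℚ)⟦X⟧) : fstPart (F + G) = fstPart F + fstPart G := by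
  ext m; simp [fstPart]

theorem sndPart_add (F G : (DualNumber ℚ)⟦X⟧) : sndPart (F + G) = sndPart F + sndPart G := by
  ext m; simp [sndPart]

theorem fstPart_mul (F G : (DualNumber ℚ)⟦X⟧) : fstPart (F * G) = fstPart F * fstPart G := by
  ext m; simp [fstPart, coeff_mul, TrivSqZeroExt.fst_sum]

theorem sndPart_mul (F G : (DualNumber ℚ)⟦X⟧) :
    sndPart (F * G) = fstPart F * sndPart G + sndPart F * fstPart G := by
  ext m
  simp [sndPart, fstPart, coeff_mul, TrivSqZeroExt.snd_sum, Finset.sum_add_distrib]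

theorem fstPart_one : fstPart 1 = 1 := by
  ext m; simp only [fstPart, coeff_mk, coeff_one]; split_ifs <;> simp

theorem sndPart_one : sndPart 1 = 0 := by
  ext m; simp only [sndPart, coeff_mk, coeff_one]; split_ifs <;> simp

theorem fstPart_X : fstPart X = X := by
  ext m; simp only [fstPart, coeff_mk, coeff_X]; split_ifs <;> simp

theorem sndPart_X : sndPart X = 0 := by
  ext m; simp only [sndPart, coeff_mk, coeff_X]; split_ifs <;> simp

theorem fstPart_C (a : DualNumber ℚ) : fstPart (C a) = C a.fst := by
  ext m; simp only [fstPart, coeff_mk, coeff_C]; split_ifs <;> simp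

theorem sndPart_C (a : DualNumber ℚ) : sndPart (C a) = C a.snd := by
  ext m; simp only [sndPart, coeff_mk, coeff_C]; split_ifs <;> simp

theorem coeff_X_mul_derivative (F : ℚ⟦X⟧) (m : ℕ) : coeff m (X * d⁄dX ℚ F) = m * coeff m F := by
  cases m with
  | zero => simp
  | succ m => rw [coeff_succ_X_mul, coeff_derivative]; push_cast; ring

/-- The linear relations between the coefficients of the counting series `f`, `h` and the series
`g`, `k` of total numbers of labels `1`. All four series are rational in `h`, which satisfies `h = 1
+ X h⁵`. With `θ = X d/dX` the relations say `5 θ g + g = 3 θ² f` and `5 k = 3 θ h + 2 (h - 1)`. -/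
theorem coeff_relations {f h g k : ℚ⟦X⟧}
    (hf : f = 1 + X * (f ^ 3 + f ^ 2 * h)) (hh : h = 1 + X * (f ^ 2 * h))
    (hg : g = X * (f ^ 3 + 3 * f ^ 2 * g + 2 * f * g * h + f ^ 2 * k))
    (hk : k = X * (f ^ 2 * h + 2 * f * g * h + f ^ 2 * k)) (m : ℕ) :
    (5 * (m : ℚ) + 1) * coeff m g = 3 * (m : ℚ) ^ 2 * coeff m f ∧
      (m ≠ 0 → 5 * coeff m k = (3 * (m : ℚ) + 2) * coeff m h) := by
  have hfh : f = h ^ 2 := by linear_combination (-f) * hh + h * (hf - hh)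
  subst hfh
  have hu : X * h ^ 5 = h - 1 := by linear_combination -hh
  have hc : constantCoeff h = 1 := by
    have := congrArg constantCoeff hh
    simpa using this
  have hne : h ≠ 0 := by
    rintro rfl
    simp at hc
  have hne' : 5 - 4 * h ≠ 0 := by
    intro h0
    have := congrArg constantCoeff h0
    rw [map_sub, map_mul, map_ofNat, map_ofNat, hc, map_zero] at this
    norm_num at this
  -- Multiplied by suitable powers of `h`, all equations lose `X` through `X h⁵ = h - 1`.
  have hk₁ : h * k = h ^ 2 * (h - 1) + 2 * (h - 1) * g := by
    linear_combination h ^ 2 * hk + (h ^ 2 + 2 * g + h * k) * hu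
  have hg₁ : g * (5 - 4 * h) = h * (h - 1) * (2 * h - 1) := by
    refine mul_left_cancel₀ hne ?_
    linear_combination h ^ 2 * hg + (h ^ 3 + 3 * h * g + 2 * g + h * k) * hu + (h - 1) * hk₁
  have hk₂ : k * (5 - 4 * h) = (h - 1) * (2 - h) := by
    refine mul_left_cancel₀ hne ?_
    linear_combination (5 - 4 * h) * hk₁ + 2 * (h - 1) * hg₁
  -- `d = θ h` and `e = θ² h`
  obtain ⟨d, hd⟩ : ∃ d, d = X * d⁄dX ℚ h := ⟨_, rfl⟩
  obtain ⟨e, he⟩ : ∃ e, e = X * d⁄dX ℚ d := ⟨_, rfl⟩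
  have hn (a : ℕ) : d⁄dX ℚ (a : ℚ⟦X⟧) = 0 := Derivation.map_natCast _ a
  have h1 : d⁄dX ℚ (1 : ℚ⟦X⟧) = 0 := by simp
  have h2 : d⁄dX ℚ (2 : ℚ⟦X⟧) = 0 := hn 2
  have h4 : d⁄dX ℚ (4 : ℚ⟦X⟧) = 0 := hn 4
  have h5 : d⁄dX ℚ (5 : ℚ⟦X⟧) = 0 := hn 5
  have hd₁ : d * (5 - 4 * h) = h * (h - 1) := by
    have := congrArg (d⁄dX ℚ) hu
    simp only [Derivation.leibniz, Derivation.leibniz_pow, map_sub, h1, derivative_X,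
      smul_eq_mul, nsmul_eq_mul] at this
    push_cast at this
    linear_combination (-X * h) * this + h * hu + 5 * d * hu + (h - 5 * X * h ^ 5) * hd
  have he₁ : e * (5 - 4 * h) - 4 * d ^ 2 = (2 * h - 1) * d := by
    have := congrArg (d⁄dX ℚ) hd₁
    simp only [Derivation.leibniz, map_sub, h1, h4, h5, smul_eq_mul] at this
    linear_combination X * this + (5 - 4 * h) * he - (4 * d + (2 * h - 1)) * hd
  have hkd : 5 * k = 3 * d + 2 * (h - 1) := by
    refine mul_right_cancel₀ hne' ?_
    linear_combination 5 * hk₂ - 3 * hd₁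
  have hgd : g = d * (2 * h - 1) := by
    refine mul_right_cancel₀ hne' ?_
    linear_combination hg₁ - (2 * h - 1) * hd₁
  have hgθ : X * d⁄dX ℚ g = e * (2 * h - 1) + 2 * d ^ 2 := by
    rw [hgd]
    simp only [Derivation.leibniz, map_sub, h1, h2, smul_eq_mul]
    linear_combination -(2 * h - 1) * he - 2 * d * hd
  have hfθ : X * d⁄dX ℚ (h ^ 2) = 2 * h * d := by
    simp only [Derivation.leibniz_pow, smul_eq_mul, nsmul_eq_mul]
    push_cast
    linear_combination -2 * h * hd
  have hfθθ : X * d⁄dX ℚ (X * d⁄dX ℚ (h ^ 2)) = 2 * d ^ 2 + 2 * h * e := by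
    rw [hfθ]
    simp only [Derivation.leibniz, h2, smul_eq_mul]
    linear_combination -2 * d * hd - 2 * h * he
  have hgf : 5 * (X * d⁄dX ℚ g) + g = 3 * (X * d⁄dX ℚ (X * d⁄dX ℚ (h ^ 2))) := by
    rw [hgθ, hfθθ]
    linear_combination hgd - he₁
  have hnum (a : ℕ) (F : ℚ⟦X⟧) : coeff m ((a : ℚ⟦X⟧) * F) = a * coeff m F := by
    rw [← nsmul_eq_mul, map_nsmul, nsmul_eq_mul]
  constructor
  · have := congrArg (coeff m) hgf
    have e5 := hnum 5
    have e3 := hnum 3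
    push_cast at e5 e3
    rw [map_add, e5, e3, coeff_X_mul_derivative, coeff_X_mul_derivative,
      coeff_X_mul_derivative] at this
    linear_combination this
  · intro hm
    have := congrArg (coeff m) hkd
    have e5 := hnum 5
    have e3 := hnum 3
    have e2 := hnum 2
    push_cast at e5 e3 e2
    rw [map_add, e5, e3, e2, hd, coeff_X_mul_derivative, map_sub, coeff_one, if_neg hm] at this
    linear_combination this

end PowerSeries

/-! ### Averages -/

open PowerSeries in
/-- The exponent in front accounts for the root, which is not part of the forest. -/
theorem sum_pow_labelCount {R : Type*} [CommRing R] (q : R) {k n m : ℕ} [NeZero n]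
    (hn : m + 1 = n) (s : Set.Icc 1 k) :
    ∑ T ∈ kNoncrossingTrees k n s, q ^ labelCount T.2 1 =
      q ^ (if (s : ℕ) = 1 then 1 else 0) * coeff m (NCForest.genFun q k s) := by
  classical
  rw [sum_kNoncrossingTrees hn s (fun c => q ^ c), NCForest.genFun, coeff_mk, Finset.mul_sum,
    Finset.sum_filter]
  refine Finset.sum_congr rfl fun t _ => ?_
  rw [mul_ite, mul_zero, ← pow_add, Nat.add_comm]

theorem labelCount_one_add_two {n : ℕ} (ℓ : Fin n → Set.Icc 1 2) :
    labelCount ℓ 1 + labelCount ℓ 2 = n := by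
  rw [labelCount, labelCount, Finset.card_filter, Finset.card_filter, ← Finset.sum_add_distrib]
  have : ∀ v, ((if (ℓ v : ℕ) = 1 then 1 else 0) + if (ℓ v : ℕ) = 2 then 1 else 0) = 1 := by
    intro v
    have := (ℓ v).2
    rw [Set.mem_Icc] at this
    split_ifs <;> omega
  simp [this]

theorem meanLabelCount_two {n r : ℕ} [NeZero n] (hne : (kNoncrossingTrees 2 n r).Nonempty) :
    meanLabelCount 2 n r 2 = n - meanLabelCount 2 n r 1 := by
  have hcard : ((kNoncrossingTrees 2 n r).card : ℚ) ≠ 0 := by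
    exact_mod_cast hne.card_pos.ne'
  rw [meanLabelCount, meanLabelCount, eq_sub_iff_add_eq, ← add_div, ← Finset.sum_add_distrib,
    div_eq_iff hcard, mul_comm, ← nsmul_eq_mul, ← Finset.sum_const]
  refine Finset.sum_congr rfl fun T _ => ?_
  rw [add_comm]
  exact_mod_cast labelCount_one_add_two T.2

/-- In the star with centre `0` every vertex has parent `0`. -/
theorem isParentMap_star {n : ℕ} [NeZero n] :
    IsParentMap (SimpleGraph.fromRel fun i _ : Fin n => i = 0) 0 fun _ => 0 := by
  refine ⟨fun i j => ?_, fun S h0 hS => Set.eq_empty_of_forall_notMem fun j hj => h0 (hS j hj)⟩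
  rw [SimpleGraph.fromRel_adj]
  by_cases hi : i = 0 <;> by_cases hj : j = 0 <;> simp [hi, hj, eq_comm]

theorem kNoncrossingTrees_nonempty {k n r : ℕ} [NeZero n] (h1 : 1 ≤ r) (hk : r ≤ k) :
    (kNoncrossingTrees k n r).Nonempty := by
  classical
  have hk1 : 1 ≤ k := h1.trans hk
  -- a star whose vertices other than the root are labelled `1`
  refine ⟨(SimpleGraph.fromRel fun i _ : Fin n => i = 0,
    fun v => if v = 0 then ⟨r, h1, hk⟩ else ⟨1, le_rfl, hk1⟩), mem_kNoncrossingTrees.2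
    ⟨⟨⟨isParentMap_star.isTree, ?_⟩, ?_⟩, by simp⟩⟩
  · rintro a b c d hab hbc hcd ⟨-, hbd⟩
    rw [SimpleGraph.fromRel_adj] at hbd
    rcases hbd.2 with rfl | rfl
    · exact absurd hab (Fin.not_lt_zero a)
    · exact absurd hcd (Fin.not_lt_zero c)
  · intro i j hij _ _
    have hj : j ≠ 0 := fun e => absurd (e ▸ hij) (Fin.not_lt_zero i)
    simp only [hj, if_false]
    split_ifs
    · simpa using hk
    · simp only; omega

open PowerSeries in
/-- With `q = 1 + ε` in the dual numbers, `∑ q ^ c = N + S ε` records the number `N` of trees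
together with the sum `S` of the label counts `c`. For `m = 0` the second relation fails, since the
constant term of `2 (H - 1)` is `0` while that of `2 H` is `2`. In the first relation the root adds
`N` to the sum over the forests. -/
theorem meanLabelCount_relations {n m : ℕ} [NeZero n] (hn : m + 1 = n) (hm : m ≠ 0) :
    (5 * (n : ℚ) - 4) * ∑ T ∈ kNoncrossingTrees 2 n 1, (labelCount T.2 1 : ℚ) =
      (3 * (n : ℚ) ^ 2 - n - 1) * (kNoncrossingTrees 2 n 1).card ∧
    5 * ∑ T ∈ kNoncrossingTrees 2 n 2, (labelCount T.2 1 : ℚ) =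
      (3 * (n : ℚ) - 1) * (kNoncrossingTrees 2 n 2).card := by
  obtain ⟨q, hq⟩ : ∃ q : DualNumber ℚ, q = 1 + DualNumber.eps := ⟨_, rfl⟩
  have hq1 : q.fst = 1 := by simp [hq]
  have hq2 : q.snd = 1 := by simp [hq]
  have key := coeff_relations (f := fstPart (NCForest.genFun q 2 1))
    (h := fstPart (NCForest.genFun q 2 2)) (g := sndPart (NCForest.genFun q 2 1))
    (k := sndPart (NCForest.genFun q 2 2)) ?_ ?_ ?_ ?_ m
  · have hcard (r : ℕ) : ((kNoncrossingTrees 2 n r).card : ℚ) =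
        (∑ T ∈ kNoncrossingTrees 2 n r, q ^ labelCount T.2 1).fst := by
      simp [TrivSqZeroExt.fst_sum, hq]
    have hsum (r : ℕ) : ∑ T ∈ kNoncrossingTrees 2 n r, (labelCount T.2 1 : ℚ) =
        (∑ T ∈ kNoncrossingTrees 2 n r, q ^ labelCount T.2 1).snd := by
      simp [TrivSqZeroExt.snd_sum, hq]
    rw [hcard, hcard, hsum, hsum, sum_pow_labelCount q hn ⟨1, by simp⟩,
      sum_pow_labelCount q hn ⟨2, by simp⟩]
    simp only [fstPart, sndPart, coeff_mk] at key
    subst hn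
    obtain ⟨k1, k2⟩ := key
    have k2 := k2 hm
    simp only [if_true, OfNat.ofNat_ne_one, if_false, pow_one, pow_zero, one_mul,
      TrivSqZeroExt.fst_mul, TrivSqZeroExt.snd_mul, hq1, hq2, smul_eq_mul, op_smul_eq_mul,
      Nat.cast_add, Nat.cast_one]
    constructor
    · linear_combination k1
    · linear_combination k2
  · conv_lhs => rw [NCForest.genFun_two_one]
    simp only [fstPart_add, fstPart_mul, fstPart_one, fstPart_X, fstPart_C, hq1, map_one]
    ring
  · conv_lhs => rw [NCForest.genFun_two_two]
    simp only [fstPart_mul, fstPart_add, fstPart_one, fstPart_X, fstPart_C, hq1, map_one]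
    ring
  · conv_lhs => rw [NCForest.genFun_two_one]
    simp only [sndPart_add, sndPart_mul, sndPart_one, sndPart_X, sndPart_C, fstPart_add,
      fstPart_mul, fstPart_X, fstPart_C, hq1, hq2, map_one]
    ring
  · conv_lhs => rw [NCForest.genFun_two_two]
    simp only [sndPart_add, sndPart_mul, sndPart_one, sndPart_X, sndPart_C,
      fstPart_mul, fstPart_X, fstPart_C, hq1, hq2, map_one]
    ring

theorem mainTheorem12 (n : ℕ) [NeZero n] (hn : 1 < n) :
    (kNoncrossingTrees 2 n 1).Nonempty ∧ (kNoncrossingTrees 2 n 2).Nonempty ∧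
    meanLabelCount 2 n 1 1 = (3 * (n : ℚ) ^ 2 - n - 1) / (5 * n - 4) ∧
    meanLabelCount 2 n 1 2 = (2 * (n : ℚ) ^ 2 - 3 * n + 1) / (5 * n - 4) ∧
    meanLabelCount 2 n 2 1 = (3 * (n : ℚ) - 1) / 5 ∧
    meanLabelCount 2 n 2 2 = (2 * (n : ℚ) + 1) / 5 := by
  have hne₁ : (kNoncrossingTrees 2 n 1).Nonempty :=
    kNoncrossingTrees_nonempty le_rfl one_le_two
  have hne₂ : (kNoncrossingTrees 2 n 2).Nonempty :=
    kNoncrossingTrees_nonempty one_le_two le_rfl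
  have hc₁ : ((kNoncrossingTrees 2 n 1).card : ℚ) ≠ 0 := by exact_mod_cast hne₁.card_pos.ne'
  have hc₂ : ((kNoncrossingTrees 2 n 2).card : ℚ) ≠ 0 := by exact_mod_cast hne₂.card_pos.ne'
  have hn' : (1 : ℚ) < n := by exact_mod_cast hn
  have hn₄ : (5 * (n : ℚ) - 4) ≠ 0 := by linarith
  obtain ⟨h₁, h₂⟩ := meanLabelCount_relations (n := n) (m := n - 1) (by omega) (by omega)
  have e₁ : meanLabelCount 2 n 1 1 = (3 * (n : ℚ) ^ 2 - n - 1) / (5 * n - 4) := by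
    rw [meanLabelCount, div_eq_div_iff hc₁ hn₄, mul_comm, h₁]
  have e₂ : meanLabelCount 2 n 2 1 = (3 * (n : ℚ) - 1) / 5 := by
    rw [meanLabelCount, div_eq_div_iff hc₂ (by norm_num), mul_comm, h₂]
  refine ⟨hne₁, hne₂, e₁, ?_, e₂, ?_⟩
  · rw [meanLabelCount_two hne₁, e₁, eq_div_iff hn₄, sub_mul,
      div_mul_cancel₀ _ hn₄]
    ring
  · rw [meanLabelCount_two hne₂, e₂]
    ring
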